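/- **Theorem.** Let $V$ be an operator space, i.e. a norm-closed linear subspace of $\mathcal B(K)$ for some complex Hilbert space $K$, with the matrix norms on $M_n(V)$ inherited from $M_n(\mathcal B(K))=\mathcal B(K^n)$. Suppose that $V$ is $\lambda$-subcoexact for some finite $\lambda$. Then $V$ has the operator approximation property if and only if $V$ has the strong operator approximation property. The terms have the following meaning. * For a linear map $\varphi$ between spaces with matrix norms, $\varphi_n([v_{ij}])=[\varphi(v_{ij})]$ and $\|\varphi\|_{cb}=\sup_n\|\varphi_n\|$; $\varphi$ is completely bounded ($\varphi\in\mathcal{CB}$) if $\|\varphi\|_{cb}<\infty$. Put $d_{cb}(X,Y)=\inf\|\varphi\|_{cb}\|\varphi^{-1}\|_{cb}$, the infimum over all linear isomorphisms $\varphi:X\to Y$ with $\varphi$ and $\varphi^{-1}$ completely bounded ($\infty$ if there is none). * $M_n=\mathcal B(\mathbb C^n)$, and $\mathcal T_n$ is the space of trace class operators on $\mathbb C^n$ with the operator space structure $M_k(\mathcal T_n)=\mathcal{CB}(M_n,M_k)$ given by trace duality. A quotient $\mathcal T_n/W$ has the quotient norms $M_k(\mathcal T_n/W)=M_k(\mathcal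 T_n)/M_k(W)$. * A finite dimensional operator space $X$ is $\lambda$-coexact if for every $\varepsilon>0$ there are $n$ and a subspace $W\subseteq\mathcal T_n$ with $d_{cb}(X,\mathcal T_n/W)<\lambda+\varepsilon$. An operator space $V$ is $\lambda$-subcoexact if every finite dimensional subspace of $V$ is contained in a finite dimensional $\lambda$-coexact subspace of $V$. * For operator spaces $W\subseteq\mathcal B(H)$ and $V\subseteq\mathcal B(K)$, $W\check\otimes V$ denotes the minimal tensor product: the completion of $W\otimes V$ in the norm of operators on the Hilbert space tensor product of $H$ and $K$. Every $\varphi\in\mathcal{CB}(V,V)$ induces a bounded map $\mathrm{id}\otimes\varphi$ on $W\check\otimes V$. * $V$ has the operator approximation property if $\mathrm{id}_V$ lies in the closure of the completely bounded finite rank maps $V\to V$ in the stable point-norm topology, the coarsest topology on $\mathcal{CB}(V,V)$ making $\varphi\mapsto(\mathrm{id}\otimes\varphi)(u)$ norm continuous for every $u\in\mathcal K(\ell^2)\check\otimes V$. It has the strong operator approximation property if the same holds for the strongly stable point-norm topology, in which $u$ ranges over $\mathcal B(H)\check\otimes V$ for all Hilbert spaces $H$. -/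

import Mathlib

open scoped TensorProduct ENNReal Topology lp

universe u v

noncomputable section

namespace OperatorSpace

/-! ### Matrix norms -/

/-- The data of a norm on `M_n(V)` for every `n`. -/
class MatrixNormed (V : Type*) [AddCommGroup V] [Module ℂ V] where
  /-- the norm of an `n × n` matrix over `V` -/
  matNorm : (n : ℕ) → Matrix (Fin n) (Fin n) V → ℝ

section Concrete

variable {H : Type*} [NormedAddCommGroup H] [InnerProductSpace ℂ H]

/-- An `n × n` matrix of bounded operators on `H`, as a bounded operator on the Hilbert space
direct sum `Hⁿ`: `(x ξ) i = ∑ j, x i j (ξ j)`. -/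
def blockOp {n : ℕ} (x : Matrix (Fin n) (Fin n) (H →L[ℂ] H)) :
    PiLp 2 (fun _ : Fin n => H) →L[ℂ] PiLp 2 (fun _ : Fin n => H) :=
  (PiLp.continuousLinearEquiv 2 ℂ (fun _ : Fin n => H)).symm.toContinuousLinearMap ∘L
    ContinuousLinearMap.pi fun i => ∑ j, x i j ∘L PiLp.proj 2 (fun _ : Fin n => H) j

/-- The matrix norms of `B(H)`: `M_n(B(H)) = B(Hⁿ)`. -/
instance instMatrixNormedOperators : MatrixNormed (H →L[ℂ] H) where
  matNorm _ x := ‖blockOp x‖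

end Concrete

/-- A subspace carries the restricted matrix norms. In particular this makes every linear space
of operators on a Hilbert space matrix normed. -/
instance instMatrixNormedSubmodule {V : Type*} [AddCommGroup V] [Module ℂ V] [MatrixNormed V]
    (W : Submodule ℂ V) : MatrixNormed W where
  matNorm n x := MatrixNormed.matNorm n (x.map W.subtype)

/-- The quotient matrix norms: `M_n(V/W) = M_n(V)/M_n(W)`. -/
instance instMatrixNormedQuotient {V : Type*} [AddCommGroup V] [Module ℂ V] [MatrixNormed V]
    (W : Submodule ℂ V) : MatrixNormed (V ⧸ W) where
  matNorm n x := sInf (MatrixNormed.matNorm n ''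
    {v : Matrix (Fin n) (Fin n) V | v.map W.mkQ = x})

/-! ### Completely bounded maps -/

section CB

variable {V W : Type*} [AddCommGroup V] [Module ℂ V] [MatrixNormed V]
  [AddCommGroup W] [Module ℂ W] [MatrixNormed W]

/-- The completely bounded norm `sup_n ‖φ_n‖`, where `φ_n [v i j] = [φ (v i j)]`; it is `∞` if
`φ` is not completely bounded. -/
def cbNorm (φ : V →ₗ[ℂ] W) : ℝ≥0∞ :=
  ⨆ (n : ℕ) (v : Matrix (Fin n) (Fin n) V) (_ : MatrixNormed.matNorm n v ≤ 1),
    ENNReal.ofReal (MatrixNormed.matNorm n (v.map φ))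

variable (V W) in
/-- The completely bounded maps from `V` to `W`. -/
def CB : Type _ := {φ : V →ₗ[ℂ] W // cbNorm φ < ∞}

variable (V W) in
/-- The completely bounded Banach-Mazur distance: the infimum of `‖e‖_cb ‖e⁻¹‖_cb` over all
complete isomorphisms `e` from `V` to `W` (`∞` if there is none). -/
def cbDist : ℝ≥0∞ :=
  ⨅ (e : V ≃ₗ[ℂ] W) (_ : cbNorm (e : V →ₗ[ℂ] W) < ∞) (_ : cbNorm (e.symm : W →ₗ[ℂ] V) < ∞),
    cbNorm (e : V →ₗ[ℂ] W) * cbNorm (e.symm : W →ₗ[ℂ] V)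

end CB

/-! ### The spaces `M_n` and `T_n`; coexactness and subcoexactness -/

/-- `M_n`, the bounded operators on the Hilbert space `ℂⁿ`. -/
abbrev MatAlg (n : ℕ) : Type := EuclideanSpace ℂ (Fin n) →L[ℂ] EuclideanSpace ℂ (Fin n)

/-- `T_n`: the trace class operators on `ℂⁿ` (all operators, with different matrix norms). -/
def TraceClass (n : ℕ) : Type := MatAlg n

instance (n : ℕ) : AddCommGroup (TraceClass n) := inferInstanceAs (AddCommGroup (MatAlg n))

instance (n : ℕ) : Module ℂ (TraceClass n) := inferInstanceAs (Module ℂ (MatAlg n))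

/-- The trace duality of `T_n` and `M_n`: `⟨t, a⟩ = Tr (t a)`. -/
def tracePairing {n : ℕ} (t : TraceClass n) : MatAlg n →ₗ[ℂ] ℂ where
  toFun a := LinearMap.trace ℂ (EuclideanSpace ℂ (Fin n))
    ((show MatAlg n from t) ∘L a : MatAlg n).toLinearMap
  map_add' a b := by
    rw [ContinuousLinearMap.comp_add, ContinuousLinearMap.toLinearMap_add, map_add]
  map_smul' c a := by
    rw [ContinuousLinearMap.comp_smul, ContinuousLinearMap.toLinearMap_smul, map_smul]
    rfl

/-- The map `M_n → M_k`, `a ↦ [⟨σ i j, a⟩]` given by a matrix `σ` over `T_n`. -/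
def traceMap {n k : ℕ} (σ : Matrix (Fin k) (Fin k) (TraceClass n)) : MatAlg n →ₗ[ℂ] MatAlg k where
  toFun a := Matrix.toEuclideanCLM (n := Fin k) (𝕜 := ℂ)
    (Matrix.of fun i j => tracePairing (σ i j) a)
  map_add' a b := by
    rw [← map_add]; congr 1; ext i j; simp
  map_smul' c a := by
    rw [RingHom.id_apply, ← map_smul]; congr 1; ext i j; simp

/-- The matrix norms of `T_n` as the dual of `M_n`: `M_k(T_n) = CB(M_n, M_k)`. -/
instance (n : ℕ) : MatrixNormed (TraceClass n) where
  matNorm _ σ := (cbNorm (traceMap σ)).toReal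

/-- `V` is `l`-coexact: for every `ε > 0` there are `n` and a subspace `W` of `T_n` such that
`d_cb(V, T_n / W) < l + ε`. -/
def Coexact (l : ℝ) (V : Type*) [AddCommGroup V] [Module ℂ V] [MatrixNormed V] : Prop :=
  ∀ ε : ℝ, 0 < ε → ∃ (n : ℕ) (W : Submodule ℂ (TraceClass n)),
    cbDist V (TraceClass n ⧸ W) < ENNReal.ofReal (l + ε)

/-- `V` is `l`-subcoexact: every finite dimensional subspace of `V` is contained in a finite
dimensional `l`-coexact subspace of `V`. -/
def Subcoexact (l : ℝ) (V : Type*) [AddCommGroup V] [Module ℂ V] [MatrixNormed V] : Prop :=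
  ∀ W : Submodule ℂ V, FiniteDimensional ℂ W →
    ∃ X : Submodule ℂ V, W ≤ X ∧ FiniteDimensional ℂ X ∧ Coexact l X

/-! ### The minimal tensor product -/

section Tensor

variable {H K L : Type*} [NormedAddCommGroup H] [InnerProductSpace ℂ H]
  [NormedAddCommGroup K] [InnerProductSpace ℂ K] [NormedAddCommGroup L] [InnerProductSpace ℂ L]

/-- The algebraic tensor product of `W ⊆ B(H)` and `V ⊆ B(K)`; it will carry the minimal
(spatial) norm. -/
def AlgTensor (W : Submodule ℂ (H →L[ℂ] H)) (V : Submodule ℂ (K →L[ℂ] K)) : Type _ :=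
  W ⊗[ℂ] V

variable {W : Submodule ℂ (H →L[ℂ] H)} {V : Submodule ℂ (K →L[ℂ] K)}
  {V' : Submodule ℂ (L →L[ℂ] L)}

instance : AddCommGroup (AlgTensor W V) := inferInstanceAs (AddCommGroup (W ⊗[ℂ] V))

instance : Module ℂ (AlgTensor W V) := inferInstanceAs (Module ℂ (W ⊗[ℂ] V))

variable (W V) in
/-- The action of `W ⊗ V` on the Hilbert space tensor product of `H` and `K` (restricted to its
dense subspace `H ⊗ K`, which does not change the operator norm):
`w ⊗ v` acts by `ξ ⊗ η ↦ w ξ ⊗ v η`. -/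
def spatial : AlgTensor W V →ₗ[ℂ] (H ⊗[ℂ] K →L[ℂ] H ⊗[ℂ] K) :=
  TensorProduct.lift (LinearMap.mk₂ ℂ
    (fun (w : W) (v : V) => TensorProduct.mapL (w : H →L[ℂ] H) (v : K →L[ℂ] K))
    (fun _ _ _ => TensorProduct.mapL_add_left _ _ _)
    (fun _ _ _ => TensorProduct.mapL_smul_left _ _ _)
    (fun _ _ _ => TensorProduct.mapL_add_right _ _ _)
    (fun _ _ _ => TensorProduct.mapL_smul_right _ _ _))

/-- The minimal norm on `W ⊗ V`. -/
instance : SeminormedAddCommGroup (AlgTensor W V) :=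
  SeminormedAddCommGroup.induced (AlgTensor W V) (H ⊗[ℂ] K →L[ℂ] H ⊗[ℂ] K) (spatial W V)

variable (W V) in
/-- The (complete) operator space minimal tensor product of `W` and `V`. -/
abbrev MinTensor : Type _ := UniformSpace.Completion (AlgTensor W V)

/-- `id ⊗ φ` on the algebraic tensor product. -/
def algAmpliation (W : Submodule ℂ (H →L[ℂ] H)) (φ : V →ₗ[ℂ] V') :
    AlgTensor W V →ₗ[ℂ] AlgTensor W V' :=
  LinearMap.lTensor W φ

/-! Completely bounded maps `φ` have a bounded ampliation `id ⊗ φ`. -/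

@[simp] lemma blockOp_apply {n : ℕ} (x : Matrix (Fin n) (Fin n) (H →L[ℂ] H))
    (ξ : PiLp 2 (fun _ : Fin n => H)) (i : Fin n) : blockOp x ξ i = ∑ j, x i j (ξ j) := by
  simp [blockOp]

lemma blockOp_smul {n : ℕ} (c : ℂ) (x : Matrix (Fin n) (Fin n) (H →L[ℂ] H)) :
    blockOp (c • x) = c • blockOp x := by
  ext ξ i
  simp [Finset.smul_sum]

lemma matNorm_smul (n : ℕ) (c : ℂ) (x : Matrix (Fin n) (Fin n) V) :
    MatrixNormed.matNorm n (c • x) = ‖c‖ * MatrixNormed.matNorm n x := by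
  change ‖blockOp ((c • x).map V.subtype)‖ = ‖c‖ * ‖blockOp (x.map V.subtype)‖
  have : NormSMulClass ℂ (PiLp 2 (fun _ : Fin n => K) →L[ℂ] PiLp 2 (fun _ : Fin n => K)) :=
    ContinuousLinearMap.toNormedSpace.toNormSMulClass
  rw [← norm_smul, ← blockOp_smul]
  congr 2

lemma matNorm_map_le {φ : V →ₗ[ℂ] V'} (hφ : cbNorm φ < ∞) (n : ℕ)
    (x : Matrix (Fin n) (Fin n) V) :
    MatrixNormed.matNorm n (x.map φ) ≤ (cbNorm φ).toReal * MatrixNormed.matNorm n x := by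
  have key : ∀ r : ℝ, MatrixNormed.matNorm n x < r →
      MatrixNormed.matNorm n (x.map φ) ≤ (cbNorm φ).toReal * r := by
    intro r hr
    have h0 : 0 ≤ MatrixNormed.matNorm n x :=
      norm_nonneg (blockOp (x.map V.subtype))
    have hr0 : 0 < r := h0.trans_lt hr
    have hn : ‖((r⁻¹ : ℝ) : ℂ)‖ = r⁻¹ := by
      rw [Complex.norm_real, Real.norm_of_nonneg (by positivity)]
    have h1 : MatrixNormed.matNorm n (((r⁻¹ : ℝ) : ℂ) • x) ≤ 1 := by
      rw [matNorm_smul, hn, inv_mul_le_iff₀ hr0]; linarith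
    have h2 : ENNReal.ofReal (MatrixNormed.matNorm n ((((r⁻¹ : ℝ) : ℂ) • x).map φ)) ≤ cbNorm φ :=
      le_iSup_of_le n (le_iSup_of_le _ (le_iSup_of_le h1 le_rfl))
    have h3 : (((r⁻¹ : ℝ) : ℂ) • x).map φ = ((r⁻¹ : ℝ) : ℂ) • x.map φ := by
      ext i j; simp
    rw [h3, matNorm_smul, hn, ENNReal.ofReal_le_iff_le_toReal hφ.ne, inv_mul_le_iff₀ hr0] at h2
    linarith
  refine le_of_forall_pos_le_add fun ε hε => ?_
  have hC : 0 ≤ (cbNorm φ).toReal := ENNReal.toReal_nonneg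
  have := key (MatrixNormed.matNorm n x + ε / ((cbNorm φ).toReal + 1))
    (by have : 0 < ε / ((cbNorm φ).toReal + 1) := by positivity
        linarith)
  refine this.trans ?_
  rw [mul_add]
  have : (cbNorm φ).toReal * (ε / ((cbNorm φ).toReal + 1)) ≤ ε := by
    rw [mul_div_assoc', div_le_iff₀ (by positivity)]; nlinarith
  linarith

/-- The elementary tensors. -/
def tmul (w : W) (v : V) : AlgTensor W V := w ⊗ₜ[ℂ] v

lemma tensor_induction {p : AlgTensor W V → Prop} (h0 : p 0) (ht : ∀ w v, p (tmul w v))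
    (ha : ∀ a b, p a → p b → p (a + b)) (u : AlgTensor W V) : p u :=
  TensorProduct.induction_on (motive := fun z : W ⊗[ℂ] V => p z) u h0 ht ha

lemma spatial_tmul (w : W) (v : V) :
    spatial W V (tmul w v) = TensorProduct.mapL (w : H →L[ℂ] H) (v : K →L[ℂ] K) := rfl

lemma algAmpliation_tmul (φ : V →ₗ[ℂ] V') (w : W) (v : V) :
    algAmpliation W φ (tmul w v) = tmul w (φ v) := rfl

/-- The linear map `w ⊗ v ↦ ⟨x, w y⟩ v`. -/
def sliceMap (x y : H) : AlgTensor W V →ₗ[ℂ] V :=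
  TensorProduct.lift (LinearMap.mk₂ ℂ (fun (w : W) (v : V) => (inner ℂ x ((w : H →L[ℂ] H) y)) • v)
    (fun _ _ _ => by simp [add_smul])
    (fun _ _ _ => by simp [mul_smul])
    (fun _ _ _ => by simp)
    (fun _ _ _ => by rw [smul_comm]))

lemma sliceMap_tmul (x y : H) (w : W) (v : V) :
    sliceMap x y (tmul w v) = (inner ℂ x ((w : H →L[ℂ] H) y)) • v := rfl

/-- The matrix over `V` obtained from a tensor by compressing the first factor. -/
def slice {n : ℕ} (e : Fin n → H) (u : AlgTensor W V) : Matrix (Fin n) (Fin n) V :=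
  Matrix.of fun i j => sliceMap (e i) (e j) u

lemma slice_algAmpliation {n : ℕ} (e : Fin n → H) (φ : V →ₗ[ℂ] V') (u : AlgTensor W V) :
    slice e (algAmpliation W φ u) = (slice e u).map φ := by
  ext1 i j
  simp only [slice, Matrix.of_apply, Matrix.map_apply]
  refine tensor_induction (p := fun u => sliceMap (e i) (e j) (algAmpliation W φ u) =
    φ (sliceMap (e i) (e j) u)) ?_ (fun w v => ?_) (fun a b ha hb => ?_) u
  · simp only [map_zero]
  · rw [algAmpliation_tmul, sliceMap_tmul, sliceMap_tmul, map_smul]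
  · rw [map_add, map_add, map_add, ha, hb, map_add]

/-- The map `Kⁿ → H ⊗ K`, `κ ↦ ∑ j, e j ⊗ κ j`. -/
def combine {n : ℕ} (e : Fin n → H) (κ : PiLp 2 (fun _ : Fin n => K)) : H ⊗[ℂ] K :=
  ∑ j, e j ⊗ₜ[ℂ] κ j

lemma inner_combine {n : ℕ} (e : Fin n → H) (u : AlgTensor W V)
    (κ κ' : PiLp 2 (fun _ : Fin n => K)) :
    inner ℂ (combine e κ') (spatial W V u (combine e κ)) =
      inner ℂ κ' (blockOp ((slice e u).map V.subtype) κ) := by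
  have h : ∀ u : AlgTensor W V, inner ℂ κ' (blockOp ((slice e u).map V.subtype) κ) =
      ∑ i, ∑ j, inner ℂ (κ' i) ((sliceMap (e i) (e j) u : K →L[ℂ] K) (κ j)) := by
    intro u
    simp [PiLp.inner_apply, slice, inner_sum]
  rw [h]
  refine tensor_induction (p := fun u => inner ℂ (combine e κ') (spatial W V u (combine e κ)) =
    ∑ i, ∑ j, inner ℂ (κ' i) ((sliceMap (e i) (e j) u : K →L[ℂ] K) (κ j)))
    ?_ (fun w v => ?_) (fun a b ha hb => ?_) u
  · simp
  · rw [spatial_tmul]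
    simp only [sliceMap_tmul]
    simp only [combine, map_sum, TensorProduct.mapL_tmul, sum_inner, inner_sum,
      TensorProduct.inner_tmul, Submodule.coe_smul, smul_apply,
      inner_smul_right]
    rw [Finset.sum_comm]
  · rw [map_add, add_apply, inner_add_right, ha, hb]
    simp only [map_add, Submodule.coe_add, add_apply, inner_add_right,
      Finset.sum_add_distrib]

lemma norm_combine {n : ℕ} {e : Fin n → H} (he : Orthonormal ℂ e)
    (κ : PiLp 2 (fun _ : Fin n => K)) : ‖combine e κ‖ = ‖κ‖ := by
  have : inner ℂ (combine e κ) (combine e κ) = inner ℂ κ κ := by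
    rw [PiLp.inner_apply]
    simp only [combine, sum_inner, inner_sum, TensorProduct.inner_tmul,
      orthonormal_iff_ite.1 he]
    simp
  rw [@norm_eq_sqrt_re_inner ℂ, @norm_eq_sqrt_re_inner ℂ, this]

lemma norm_le_of_inner {E : Type*} [NormedAddCommGroup E] [InnerProductSpace ℂ E] {b : E} {C : ℝ}
    (hC : 0 ≤ C) (h : ‖inner ℂ b b‖ ≤ ‖b‖ * C) : ‖b‖ ≤ C := by
  have h1 : ‖b‖ ^ 2 ≤ ‖b‖ * C := by
    rw [inner_self_eq_norm_sq_to_K] at h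
    simpa using h
  rcases (norm_nonneg b).eq_or_lt with h0 | h0
  · rw [← h0]; exact hC
  · rw [sq] at h1; exact le_of_mul_le_mul_left h1 h0

lemma norm_slice_le {n : ℕ} {e : Fin n → H} (he : Orthonormal ℂ e) (u : AlgTensor W V) :
    MatrixNormed.matNorm n (slice e u) ≤ ‖u‖ := by
  refine ContinuousLinearMap.opNorm_le_bound (blockOp ((slice e u).map V.subtype))
    (norm_nonneg _) fun κ => ?_
  set b := blockOp ((slice e u).map V.subtype) κ with hb
  have h := inner_combine e u κ b
  rw [← hb] at h
  refine norm_le_of_inner (by positivity) ?_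
  have h1 := norm_combine he b
  have h2 := norm_combine he κ
  rw [← h, ← h1, ← h2]
  refine (norm_inner_le_norm (𝕜 := ℂ) (combine e b) (spatial W V u (combine e κ))).trans ?_
  gcongr
  exact ContinuousLinearMap.le_opNorm (spatial W V u) _

lemma exists_combine (N : Submodule ℂ H) {n : ℕ} (e : OrthonormalBasis (Fin n) ℂ N)
    (z : N ⊗[ℂ] K) :
    ∃ κ, combine (fun i => (e i : H)) κ = LinearMap.rTensor K N.subtype z := by
  induction z using TensorProduct.induction_on with
  | zero => exact ⟨0, by simp [combine]⟩
  | tmul x k =>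
    refine ⟨WithLp.toLp 2 fun i => e.repr x i • k, ?_⟩
    conv_rhs => rw [← e.sum_repr x]
    simp [combine, TensorProduct.sum_tmul, TensorProduct.smul_tmul']
  | add a b ha hb =>
    obtain ⟨α, hα⟩ := ha
    obtain ⟨β, hβ⟩ := hb
    refine ⟨α + β, ?_⟩
    rw [map_add, ← hα, ← hβ]
    simp [combine, TensorProduct.tmul_add, Finset.sum_add_distrib]

lemma norm_algAmpliation_le (W : Submodule ℂ (H →L[ℂ] H)) {φ : V →ₗ[ℂ] V'}
    (hφ : cbNorm φ < ∞) (u : AlgTensor W V) :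
    ‖algAmpliation W φ u‖ ≤ (cbNorm φ).toReal * ‖u‖ := by
  refine ContinuousLinearMap.opNorm_le_bound (spatial W V' (algAmpliation W φ u))
    (by positivity) fun ξ => ?_
  set η := spatial W V' (algAmpliation W φ u) ξ with hη
  obtain ⟨N, hN, hs⟩ := TensorProduct.exists_finite_submodule_left_of_setFinite {ξ, η}
    (Set.toFinite _)
  have : FiniteDimensional ℂ N := hN
  obtain ⟨z, hz⟩ := hs (Set.mem_insert ξ {η})
  obtain ⟨z', hz'⟩ := hs (Set.mem_insert_of_mem ξ (Set.mem_singleton η))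
  let e := stdOrthonormalBasis ℂ N
  obtain ⟨κ, hκ⟩ := exists_combine N e z
  obtain ⟨κ', hκ'⟩ := exists_combine N e z'
  rw [hz] at hκ
  rw [hz'] at hκ'
  have he : Orthonormal ℂ (fun i => (e i : H)) := e.orthonormal.comp_linearIsometry N.subtypeₗᵢ
  have h := inner_combine (fun i => (e i : H)) (algAmpliation W φ u) κ κ'
  rw [hκ, hκ', ← hη, slice_algAmpliation] at h
  have h1 : ‖κ‖ = ‖ξ‖ := by rw [← norm_combine he, hκ]
  have h2 : ‖κ'‖ = ‖η‖ := by rw [← norm_combine he, hκ']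
  have h3 := matNorm_map_le hφ _ (slice (fun i => (e i : H)) u)
  have h4 := norm_slice_le he u
  refine norm_le_of_inner (by positivity) ?_
  rw [h, ← h1, ← h2]
  refine (norm_inner_le_norm (𝕜 := ℂ) _ _).trans ?_
  gcongr
  refine (ContinuousLinearMap.le_opNorm _ κ).trans ?_
  gcongr
  exact h3.trans (by gcongr)

/-- The ampliation `id ⊗ φ` of a completely bounded map `φ`, on the complete minimal tensor
product: the continuous extension of `w ⊗ v ↦ w ⊗ φ v`. -/
def ampliation (W : Submodule ℂ (H →L[ℂ] H)) (φ : CB V V') : MinTensor W V → MinTensor W V' :=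
  ((algAmpliation W φ.1).toAddMonoidHom.mkNormedAddGroupHom _
    (norm_algAmpliation_le W φ.2)).completion

end Tensor

/-! ### The operator approximation properties -/

section Approximation

variable {K : Type u} [NormedAddCommGroup K] [InnerProductSpace ℂ K]
  {L : Type*} [NormedAddCommGroup L] [InnerProductSpace ℂ L]

/-- The compact operators `𝒦` on `ℓ²`. -/
abbrev compacts : Submodule ℂ (ℓ²(ℕ, ℂ) →L[ℂ] ℓ²(ℕ, ℂ)) :=
  compactOperator (RingHom.id ℂ) ℓ²(ℕ, ℂ) ℓ²(ℕ, ℂ)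

/-- All bounded operators on `H`, as an operator space. -/
abbrev allOps (H : Type*) [NormedAddCommGroup H] [InnerProductSpace ℂ H] :
    Submodule ℂ (H →L[ℂ] H) := ⊤

/-- The stable point-norm topology on `CB(V, V')`: the coarsest topology for which
`φ ↦ (id ⊗ φ) u` is norm continuous for every `u` in `𝒦 ⊗ V`. -/
abbrev stablePointNorm (V : Submodule ℂ (K →L[ℂ] K)) (V' : Submodule ℂ (L →L[ℂ] L)) :
    TopologicalSpace (CB V V') :=
  ⨅ u : MinTensor compacts V,
    TopologicalSpace.induced (fun φ => ampliation compacts φ u) inferInstance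

/-- The strongly stable point-norm topology on `CB(V, V')`: the coarsest topology for which
`φ ↦ (id ⊗ φ) u` is norm continuous for every Hilbert space `H` and every `u` in `B(H) ⊗ V`. -/
abbrev stronglyStablePointNorm (V : Submodule ℂ (K →L[ℂ] K)) (V' : Submodule ℂ (L →L[ℂ] L)) :
    TopologicalSpace (CB V V') :=
  ⨅ (H : Type v) (_ : NormedAddCommGroup H) (_ : InnerProductSpace ℂ H) (_ : CompleteSpace H)
    (u : MinTensor (allOps H) V),
    TopologicalSpace.induced (fun φ => ampliation (allOps H) φ u) inferInstance

/-- The completely bounded maps of finite rank. -/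
def finiteRank (V : Submodule ℂ (K →L[ℂ] K)) : Set (CB V V) :=
  {φ | FiniteDimensional ℂ (LinearMap.range φ.1)}

lemma cbNorm_id_lt_top (V : Submodule ℂ (K →L[ℂ] K)) : cbNorm (LinearMap.id : V →ₗ[ℂ] V) < ∞ := by
  refine lt_of_le_of_lt (iSup_le fun n => iSup_le fun v => iSup_le fun hv => ?_)
    ENNReal.one_lt_top
  exact ENNReal.ofReal_le_one.2 hv

/-- The identity map as a completely bounded map. -/
def idCB (V : Submodule ℂ (K →L[ℂ] K)) : CB V V := ⟨LinearMap.id, cbNorm_id_lt_top V⟩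

/-- The operator approximation property: the identity is a limit of completely bounded finite
rank maps in the stable point-norm topology. -/
def OAP (V : Submodule ℂ (K →L[ℂ] K)) : Prop :=
  idCB V ∈ closure[stablePointNorm V V] (finiteRank V)

/-- The strong operator approximation property: the identity is a limit of completely bounded
finite rank maps in the strongly stable point-norm topology. -/
def StrongOAP (V : Submodule ℂ (K →L[ℂ] K)) : Prop :=
  idCB V ∈ closure[stronglyStablePointNorm.{u, v, u} V V] (finiteRank V)

end Approximation

end OperatorSpace

end

noncomputable section

namespace OperatorSpace

section Tensor

variable {H K L : Type*} [NormedAddCommGroup H] [InnerProductSpace ℂ H]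
  [NormedAddCommGroup K] [InnerProductSpace ℂ K] [NormedAddCommGroup L] [InnerProductSpace ℂ L]
variable {W : Submodule ℂ (H →L[ℂ] H)} {V : Submodule ℂ (K →L[ℂ] K)}
  {V' : Submodule ℂ (L →L[ℂ] L)}

lemma algTensor_norm_def (u : AlgTensor W V) : ‖u‖ = ‖spatial W V u‖ := rfl

lemma matNorm_def {n : ℕ} (x : Matrix (Fin n) (Fin n) V) :
    MatrixNormed.matNorm n x = ‖blockOp (x.map V.subtype)‖ := rfl

lemma matNorm_nonneg {n : ℕ} (x : Matrix (Fin n) (Fin n) V) : 0 ≤ MatrixNormed.matNorm n x :=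
  norm_nonneg (blockOp (x.map V.subtype))

/-- The minimal norm is determined by the compressions to finite dimensional subspaces of the
first Hilbert space. -/
lemma norm_le_of_forall_slice {u : AlgTensor W V} {R : ℝ} (hR : 0 ≤ R)
    (h : ∀ (n : ℕ) (e : Fin n → H), Orthonormal ℂ e → MatrixNormed.matNorm n (slice e u) ≤ R) :
    ‖u‖ ≤ R := by
  refine ContinuousLinearMap.opNorm_le_bound (spatial W V u) hR fun ξ => ?_
  set η := spatial W V u ξ with hη
  obtain ⟨N, hN, hs⟩ := TensorProduct.exists_finite_submodule_left_of_setFinite {ξ, η}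
    (Set.toFinite _)
  have : FiniteDimensional ℂ N := hN
  obtain ⟨z, hz⟩ := hs (Set.mem_insert ξ {η})
  obtain ⟨z', hz'⟩ := hs (Set.mem_insert_of_mem ξ (Set.mem_singleton η))
  let e := stdOrthonormalBasis ℂ N
  obtain ⟨κ, hκ⟩ := exists_combine N e z
  obtain ⟨κ', hκ'⟩ := exists_combine N e z'
  rw [hz] at hκ
  rw [hz'] at hκ'
  have he : Orthonormal ℂ (fun i => (e i : H)) := e.orthonormal.comp_linearIsometry N.subtypeₗᵢ
  have hi := inner_combine (fun i => (e i : H)) u κ κ'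
  rw [hκ, hκ', ← hη] at hi
  have h1 : ‖κ‖ = ‖ξ‖ := by rw [← norm_combine he, hκ]
  have h2 : ‖κ'‖ = ‖η‖ := by rw [← norm_combine he, hκ']
  refine norm_le_of_inner (by positivity) ?_
  rw [hi, ← h1, ← h2]
  refine (norm_inner_le_norm (𝕜 := ℂ) _ _).trans ?_
  gcongr
  refine (ContinuousLinearMap.le_opNorm _ κ).trans ?_
  gcongr
  exact h _ _ he

lemma slice_sum {ι : Type*} {n : ℕ} (e : Fin n → H) (s : Finset ι) (u : ι → AlgTensor W V) :
    slice e (∑ k ∈ s, u k) = ∑ k ∈ s, slice e (u k) := by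
  ext1 i j
  simp [slice, Matrix.sum_apply]

/-- The tensor `∑ i j, |f i⟩⟨f j| ⊗ x i j`. -/
def embed {n : ℕ} (f : Fin n → H) (hf : ∀ i j, InnerProductSpace.rankOne ℂ (f i) (f j) ∈ W)
    (x : Matrix (Fin n) (Fin n) V) : AlgTensor W V :=
  ∑ i, ∑ j, tmul ⟨_, hf i j⟩ (x i j)

lemma slice_embed {m n : ℕ} (e : Fin m → H) (f : Fin n → H)
    (hf : ∀ i j, InnerProductSpace.rankOne ℂ (f i) (f j) ∈ W)
    (x : Matrix (Fin n) (Fin n) V) (i j : Fin m) :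
    slice e (embed f hf x) i j =
      ∑ p, ∑ q, (inner ℂ (e i) (f p) * inner ℂ (f q) (e j)) • x p q := by
  simp only [slice, embed, Matrix.of_apply, map_sum, sliceMap_tmul,
    InnerProductSpace.rankOne_apply, inner_smul_right]
  simp only [mul_comm]

lemma slice_embed_self {n : ℕ} {f : Fin n → H} (h : Orthonormal ℂ f)
    (hf : ∀ i j, InnerProductSpace.rankOne ℂ (f i) (f j) ∈ W)
    (x : Matrix (Fin n) (Fin n) V) : slice f (embed f hf x) = x := by
  ext1 i j
  rw [slice_embed]
  simp only [orthonormal_iff_ite.1 h]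
  simp

lemma slice_embed_of_orthogonal {m n : ℕ} {e : Fin m → H} {f : Fin n → H}
    (h : ∀ i p, inner ℂ (e i) (f p) = 0)
    (hf : ∀ i j, InnerProductSpace.rankOne ℂ (f i) (f j) ∈ W)
    (x : Matrix (Fin n) (Fin n) V) : slice e (embed f hf x) = 0 := by
  ext1 i j
  rw [slice_embed]
  simp [h]

lemma algAmpliation_embed {n : ℕ} (f : Fin n → H)
    (hf : ∀ i j, InnerProductSpace.rankOne ℂ (f i) (f j) ∈ W)
    (x : Matrix (Fin n) (Fin n) V) (φ : V →ₗ[ℂ] V') :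
    algAmpliation W φ (embed f hf x) = embed f hf (x.map φ) := by
  simp only [embed, map_sum, algAmpliation_tmul, Matrix.map_apply]

/-- The map `H ⊗ K → Kⁿ`, `ξ ⊗ η ↦ (⟨f i, ξ⟩ η)_i`, the adjoint of `combine f`. -/
def coefficients {n : ℕ} (f : Fin n → H) : H ⊗[ℂ] K →ₗ[ℂ] PiLp 2 (fun _ : Fin n => K) :=
  TensorProduct.lift (LinearMap.mk₂ ℂ (fun (h : H) (k : K) =>
      WithLp.toLp 2 fun i => (inner ℂ (f i) h) • k)
    (fun _ _ _ => by ext; simp [add_smul])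
    (fun _ _ _ => by ext; simp [mul_smul])
    (fun _ _ _ => by ext; simp)
    (fun _ _ _ => by ext i; exact smul_comm _ _ _))

lemma coefficients_tmul {n : ℕ} (f : Fin n → H) (h : H) (k : K) (i : Fin n) :
    coefficients f (h ⊗ₜ[ℂ] k) i = (inner ℂ (f i) h) • k := rfl

lemma inner_combine_left {n : ℕ} (f : Fin n → H) (κ : PiLp 2 (fun _ : Fin n => K))
    (ξ : H ⊗[ℂ] K) : inner ℂ (combine f κ) ξ = inner ℂ κ (coefficients f ξ) := by
  induction ξ using TensorProduct.induction_on with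
  | zero => simp
  | tmul h k =>
    simp [combine, PiLp.inner_apply, sum_inner, TensorProduct.inner_tmul, coefficients_tmul,
      inner_smul_right]
  | add a b ha hb => rw [map_add, inner_add_right, inner_add_right, ha, hb]

lemma norm_coefficients_le {n : ℕ} {f : Fin n → H} (hf : Orthonormal ℂ f) (ξ : H ⊗[ℂ] K) :
    ‖coefficients f ξ‖ ≤ ‖ξ‖ := by
  refine norm_le_of_inner (norm_nonneg ξ) ?_
  rw [← inner_combine_left, ← norm_combine hf]
  exact norm_inner_le_norm (combine f (coefficients f ξ)) ξ

lemma spatial_embed {n : ℕ} (f : Fin n → H)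
    (hf : ∀ i j, InnerProductSpace.rankOne ℂ (f i) (f j) ∈ W)
    (x : Matrix (Fin n) (Fin n) V) (ξ : H ⊗[ℂ] K) :
    spatial W V (embed f hf x) ξ =
      combine f (blockOp (x.map V.subtype) (coefficients f ξ)) := by
  have hc : ∀ κ κ' : PiLp 2 (fun _ : Fin n => K), combine f (κ + κ') =
      combine f κ + combine f κ' := by
    intro κ κ'
    simp [combine, TensorProduct.tmul_add, Finset.sum_add_distrib]
  induction ξ using TensorProduct.induction_on with
  | zero => simp [combine]
  | tmul h k =>
    simp only [embed, map_sum, sum_apply, spatial_tmul,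
      TensorProduct.mapL_tmul, InnerProductSpace.rankOne_apply, combine, blockOp_apply,
      coefficients_tmul, Matrix.map_apply, Submodule.subtype_apply, map_smul,
      TensorProduct.tmul_sum, TensorProduct.smul_tmul]
  | add a b ha hb => rw [map_add, map_add, map_add, hc, ha, hb]

lemma norm_embed_le {n : ℕ} {f : Fin n → H} (h : Orthonormal ℂ f)
    (hf : ∀ i j, InnerProductSpace.rankOne ℂ (f i) (f j) ∈ W)
    (x : Matrix (Fin n) (Fin n) V) : ‖embed f hf x‖ ≤ MatrixNormed.matNorm n x := by
  refine ContinuousLinearMap.opNorm_le_bound (spatial W V (embed f hf x)) (matNorm_nonneg x)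
    fun ξ => ?_
  rw [spatial_embed, norm_combine h, matNorm_def]
  refine (ContinuousLinearMap.le_opNorm _ _).trans ?_
  gcongr
  exact norm_coefficients_le h ξ

/-- A tensor has its slices in a finite dimensional subspace of the second factor. -/
lemma exists_finiteDimensional_slice_mem (u : AlgTensor W V) :
    ∃ X : Submodule ℂ V, FiniteDimensional ℂ X ∧ ∀ x y : H, sliceMap x y u ∈ X := by
  refine tensor_induction (p := fun u => ∃ X : Submodule ℂ V, FiniteDimensional ℂ X ∧
    ∀ x y : H, sliceMap x y u ∈ X) ?_ (fun w v => ?_) (fun a b ha hb => ?_) u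
  · exact ⟨⊥, inferInstance, fun x y => by rw [map_zero]; exact zero_mem _⟩
  · refine ⟨ℂ ∙ v, inferInstance, fun x y => ?_⟩
    rw [sliceMap_tmul]
    exact Submodule.smul_mem _ _ (Submodule.mem_span_singleton_self v)
  · obtain ⟨X, hX, ha⟩ := ha
    obtain ⟨Y, hY, hb⟩ := hb
    refine ⟨X ⊔ Y, inferInstance, fun x y => ?_⟩
    rw [map_add]
    exact add_mem (Submodule.mem_sup_left (ha x y)) (Submodule.mem_sup_right (hb x y))

end Tensor

section MatrixUnits

/-- The matrix units of `M_n`. -/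
def matUnit {n : ℕ} (p q : Fin n) : MatAlg n :=
  InnerProductSpace.rankOne ℂ (EuclideanSpace.basisFun (Fin n) ℂ p)
    (EuclideanSpace.basisFun (Fin n) ℂ q)

/-- The matrix entries of an operator on `ℂⁿ`. -/
def entry {n : ℕ} (p q : Fin n) : MatAlg n →ₗ[ℂ] ℂ where
  toFun a := a (EuclideanSpace.basisFun (Fin n) ℂ q) p
  map_add' _ _ := by simp
  map_smul' _ _ := by simp

lemma entry_eq_inner {n : ℕ} (p q : Fin n) (a : MatAlg n) :
    entry p q a = inner ℂ (EuclideanSpace.basisFun (Fin n) ℂ p)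
      (a (EuclideanSpace.basisFun (Fin n) ℂ q)) := by
  simp [entry, EuclideanSpace.inner_single_left]

lemma sum_entry_smul_matUnit {n : ℕ} (a : MatAlg n) :
    ∑ p, ∑ q, entry p q a • matUnit p q = a := by
  refine ContinuousLinearMap.coe_injective ((EuclideanSpace.basisFun (Fin n) ℂ).toBasis.ext
    fun j => ?_)
  simp only [OrthonormalBasis.coe_toBasis, ContinuousLinearMap.coe_coe, sum_apply, smul_apply,
    matUnit, InnerProductSpace.rankOne_apply,
    orthonormal_iff_ite.1 (EuclideanSpace.basisFun (Fin n) ℂ).orthonormal, entry_eq_inner]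
  conv_rhs => rw [← (EuclideanSpace.basisFun (Fin n) ℂ).sum_repr' (a _)]
  simp

lemma ext_entry {n : ℕ} {a b : MatAlg n} (h : ∀ p q, entry p q a = entry p q b) : a = b := by
  rw [← sum_entry_smul_matUnit a, ← sum_entry_smul_matUnit b]
  simp only [h]

lemma entry_toEuclideanCLM {n : ℕ} (A : Matrix (Fin n) (Fin n) ℂ) (p q : Fin n) :
    entry p q (Matrix.toEuclideanCLM (n := Fin n) (𝕜 := ℂ) A) = A p q := by
  simp [entry, Matrix.ofLp_toEuclideanCLM]

lemma tracePairing_matUnit_right {n : ℕ} (t : MatAlg n) (p q : Fin n) :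
    tracePairing (n := n) t (matUnit p q) = entry q p t := by
  change LinearMap.trace ℂ (EuclideanSpace ℂ (Fin n)) (t ∘L matUnit p q : MatAlg n).toLinearMap = _
  rw [matUnit, InnerProductSpace.comp_rankOne, InnerProductSpace.trace_rankOne, entry_eq_inner]

lemma tracePairing_matUnit_left {n : ℕ} (a : MatAlg n) (p q : Fin n) :
    tracePairing (n := n) (matUnit p q) a = entry q p a := by
  change LinearMap.trace ℂ (EuclideanSpace ℂ (Fin n)) (matUnit p q ∘L a : MatAlg n).toLinearMap = _
  rw [ContinuousLinearMap.toLinearMap_comp, LinearMap.trace_comp_comm',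
    ← ContinuousLinearMap.toLinearMap_comp]
  exact tracePairing_matUnit_right a p q

/-- The matrix over `T_n` whose trace map is the identity of `M_n`. -/
def dualUnits (n : ℕ) : Matrix (Fin n) (Fin n) (TraceClass n) :=
  Matrix.of fun i j => (matUnit j i : MatAlg n)

lemma entry_traceMap {n k : ℕ} (σ : Matrix (Fin k) (Fin k) (TraceClass n)) (a : MatAlg n)
    (i j : Fin k) : entry i j (traceMap σ a) = tracePairing (σ i j) a :=
  entry_toEuclideanCLM _ i j

lemma traceMap_dualUnits (n : ℕ) : traceMap (dualUnits n) = LinearMap.id := by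
  ext1 a
  refine ext_entry fun i j => ?_
  rw [entry_traceMap]
  exact tracePairing_matUnit_left a j i

/-- Every matrix over `T_n` is obtained from `dualUnits n` by applying its trace map. -/
lemma eq_sum_dualUnits {n k : ℕ} (σ : Matrix (Fin k) (Fin k) (TraceClass n)) (i j : Fin k) :
    σ i j = ∑ p, ∑ q, entry i j (traceMap σ (matUnit p q)) • dualUnits n p q := by
  simp only [entry_traceMap]
  rw [Finset.sum_comm]
  refine (sum_entry_smul_matUnit (n := n) (σ i j)).symm.trans ?_
  refine Finset.sum_congr rfl fun p _ => Finset.sum_congr rfl fun q _ => ?_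
  exact congrArg (fun c : ℂ => c • (matUnit p q : MatAlg n))
    (tracePairing_matUnit_right (n := n) (σ i j) q p).symm

lemma matNorm_dualUnits_le (n : ℕ) : MatrixNormed.matNorm n (dualUnits n) ≤ 1 := by
  change (cbNorm (traceMap (dualUnits n))).toReal ≤ 1
  refine ENNReal.toReal_le_of_le_ofReal zero_le_one ?_
  rw [traceMap_dualUnits, ENNReal.ofReal_one]
  refine iSup_le fun m => iSup_le fun v => iSup_le fun hv => ENNReal.ofReal_le_one.2 hv

end MatrixUnits

section FiniteDimensional

variable {H K : Type*} [NormedAddCommGroup H] [InnerProductSpace ℂ H]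
  [NormedAddCommGroup K] [InnerProductSpace ℂ K]

lemma blockOp_add {n : ℕ} (x y : Matrix (Fin n) (Fin n) (H →L[ℂ] H)) :
    blockOp (x + y) = blockOp x + blockOp y := by
  ext ξ i
  simp [Finset.sum_add_distrib]

lemma cbNorm_add_le {V : Type*} [AddCommGroup V] [Module ℂ V] [MatrixNormed V]
    (φ ψ : V →ₗ[ℂ] (H →L[ℂ] H)) : cbNorm (φ + ψ) ≤ cbNorm φ + cbNorm ψ := by
  refine iSup_le fun n => iSup_le fun v => iSup_le fun hv => ?_
  have h : MatrixNormed.matNorm n (v.map (φ + ψ)) ≤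
      MatrixNormed.matNorm n (v.map φ) + MatrixNormed.matNorm n (v.map ψ) := by
    have e : v.map (φ + ψ) = v.map φ + v.map ψ := by ext1 i j; simp
    rw [e]
    change ‖blockOp (H := H) _‖ ≤ ‖blockOp (H := H) _‖ + ‖blockOp (H := H) _‖
    rw [blockOp_add]
    exact norm_add_le (blockOp (v.map φ)) (blockOp (v.map ψ))
  refine (ENNReal.ofReal_le_ofReal h).trans (ENNReal.ofReal_add_le.trans (add_le_add ?_ ?_))
  · exact le_iSup_of_le n (le_iSup_of_le v (le_iSup_of_le hv le_rfl))
  · exact le_iSup_of_le n (le_iSup_of_le v (le_iSup_of_le hv le_rfl))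

lemma cbNorm_sum_lt_top {ι : Type*} {V : Type*} [AddCommGroup V] [Module ℂ V] [MatrixNormed V]
    (s : Finset ι) (φ : ι → V →ₗ[ℂ] (H →L[ℂ] H)) (h : ∀ i ∈ s, cbNorm (φ i) < ∞) :
    cbNorm (∑ i ∈ s, φ i) < ∞ := by
  classical
  induction s using Finset.induction_on with
  | empty =>
    refine lt_of_le_of_lt (iSup_le fun n => iSup_le fun v => iSup_le fun hv => ?_)
      ENNReal.zero_lt_top
    rw [nonpos_iff_eq_zero, ENNReal.ofReal_eq_zero]
    have e : blockOp (v.map ((∑ i ∈ (∅ : Finset ι), φ i : V →ₗ[ℂ] (H →L[ℂ] H)))) = 0 := by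
      ext ξ i
      simp
    change ‖blockOp (H := H) _‖ ≤ 0
    rw [e]
    exact ContinuousLinearMap.opNorm_zero.le
  | insert i s hi ih =>
    rw [Finset.sum_insert hi]
    refine (cbNorm_add_le _ _).trans_lt (ENNReal.add_lt_top.2 ⟨h i (by simp), ih fun j hj => ?_⟩)
    exact h j (by simp [hj])

/-- The map `x ↦ a x b`. -/
def twoSidedMul (a : H →L[ℂ] K) (b : K →L[ℂ] H) : (H →L[ℂ] H) →ₗ[ℂ] (K →L[ℂ] K) where
  toFun x := a ∘L x ∘L b
  map_add' x y := by ext; simp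
  map_smul' c x := by ext; simp

/-- The diagonal operator `ξ ↦ (a (ξ i))_i`. -/
def diagOp (n : ℕ) (a : H →L[ℂ] K) :
    PiLp 2 (fun _ : Fin n => H) →L[ℂ] PiLp 2 (fun _ : Fin n => K) :=
  (PiLp.continuousLinearEquiv 2 ℂ (fun _ : Fin n => K)).symm.toContinuousLinearMap ∘L
    ContinuousLinearMap.pi fun i => a ∘L PiLp.proj 2 (fun _ : Fin n => H) i

lemma diagOp_apply (n : ℕ) (a : H →L[ℂ] K) (ξ : PiLp 2 (fun _ : Fin n => H)) (i : Fin n) :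
    diagOp n a ξ i = a (ξ i) := rfl

lemma norm_diagOp_le (n : ℕ) (a : H →L[ℂ] K) : ‖diagOp n a‖ ≤ ‖a‖ := by
  refine ContinuousLinearMap.opNorm_le_bound _ (norm_nonneg a) fun ξ => ?_
  refine le_of_sq_le_sq ?_ (by positivity)
  rw [mul_pow, PiLp.norm_sq_eq_of_L2, PiLp.norm_sq_eq_of_L2, Finset.mul_sum]
  refine Finset.sum_le_sum fun i _ => ?_
  rw [diagOp_apply, ← mul_pow]
  gcongr
  exact a.le_opNorm _

lemma cbNorm_twoSidedMul_lt_top (a : H →L[ℂ] K) (b : K →L[ℂ] H) :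
    cbNorm (twoSidedMul a b) < ∞ := by
  refine lt_of_le_of_lt (iSup_le fun n => iSup_le fun v => iSup_le fun hv => ?_)
    (ENNReal.ofReal_lt_top (r := ‖a‖ * ‖b‖))
  refine ENNReal.ofReal_le_ofReal ?_
  have e : blockOp (v.map (twoSidedMul a b)) = diagOp n a ∘L blockOp v ∘L diagOp n b := by
    ext ξ i
    simp [diagOp_apply, twoSidedMul]
  change ‖blockOp (H := K) _‖ ≤ _
  replace hv : ‖blockOp v‖ ≤ 1 := hv
  rw [e]
  calc ‖diagOp n a ∘L blockOp v ∘L diagOp n b‖ ≤ ‖diagOp n a‖ * (‖blockOp v‖ * ‖diagOp n b‖) :=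
        (ContinuousLinearMap.opNorm_comp_le _ _).trans (by
          gcongr; exact ContinuousLinearMap.opNorm_comp_le _ _)
    _ ≤ ‖a‖ * (1 * ‖b‖) := by gcongr <;> exact norm_diagOp_le n _
    _ = ‖a‖ * ‖b‖ := by rw [one_mul]

lemma cbNorm_matAlg_lt_top {n k : ℕ} (T : MatAlg n →ₗ[ℂ] MatAlg k) : cbNorm T < ∞ := by
  have e : T = ∑ i : Fin n × Fin n × Fin k, twoSidedMul
      (InnerProductSpace.rankOne ℂ
        (T (matUnit i.1 i.2.1) (EuclideanSpace.basisFun (Fin k) ℂ i.2.2))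
        (EuclideanSpace.basisFun (Fin n) ℂ i.1))
      (InnerProductSpace.rankOne ℂ (EuclideanSpace.basisFun (Fin n) ℂ i.2.1)
        (EuclideanSpace.basisFun (Fin k) ℂ i.2.2)) := by
    ext1 a
    refine ContinuousLinearMap.coe_injective ((EuclideanSpace.basisFun (Fin k) ℂ).toBasis.ext
      fun j => ?_)
    conv_lhs => rw [← sum_entry_smul_matUnit a]
    simp only [OrthonormalBasis.coe_toBasis, ContinuousLinearMap.coe_coe, sum_apply, map_sum,
      map_smul, smul_apply, LinearMap.sum_apply, Fintype.sum_prod_type, twoSidedMul,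
      LinearMap.coe_mk, AddHom.coe_mk, ContinuousLinearMap.comp_apply,
      InnerProductSpace.rankOne_apply,
      orthonormal_iff_ite.1 (EuclideanSpace.basisFun (Fin k) ℂ).orthonormal, ← entry_eq_inner]
    simp
  rw [e]
  exact cbNorm_sum_lt_top _ _ fun i _ => cbNorm_twoSidedMul_lt_top _ _

end FiniteDimensional

section Transfer

variable {L : Type*} [NormedAddCommGroup L] [InnerProductSpace ℂ L]

/-- A linear map between algebras of all operators, in terms of operator spaces. -/
def onTop {H K : Type*} [NormedAddCommGroup H] [InnerProductSpace ℂ H] [NormedAddCommGroup K]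
    [InnerProductSpace ℂ K] (T : (H →L[ℂ] H) →ₗ[ℂ] (K →L[ℂ] K)) : allOps H →ₗ[ℂ] allOps K :=
  (T ∘ₗ (allOps H).subtype).codRestrict (allOps K) fun _ => trivial

lemma cbNorm_onTop_le {H K : Type*} [NormedAddCommGroup H] [InnerProductSpace ℂ H]
    [NormedAddCommGroup K] [InnerProductSpace ℂ K] (T : (H →L[ℂ] H) →ₗ[ℂ] (K →L[ℂ] K)) :
    cbNorm (onTop T) ≤ cbNorm T := by
  refine iSup_le fun m => iSup_le fun v => iSup_le fun hv => ?_
  exact le_iSup_of_le m (le_iSup_of_le (v.map (allOps H).subtype) (le_iSup_of_le hv le_rfl))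

/-- The unitary `Lⁿ → L ⊗ ℂⁿ`. -/
def toTensor {n : ℕ} (κ : PiLp 2 (fun _ : Fin n => L)) : L ⊗[ℂ] EuclideanSpace ℂ (Fin n) :=
  ∑ j, κ j ⊗ₜ[ℂ] EuclideanSpace.basisFun (Fin n) ℂ j

lemma norm_toTensor {n : ℕ} (κ : PiLp 2 (fun _ : Fin n => L)) : ‖toTensor κ‖ = ‖κ‖ := by
  have : inner ℂ (toTensor κ) (toTensor κ) = inner ℂ κ κ := by
    rw [PiLp.inner_apply]
    simp only [toTensor, sum_inner, inner_sum, TensorProduct.inner_tmul,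
      orthonormal_iff_ite.1 (EuclideanSpace.basisFun (Fin n) ℂ).orthonormal]
    simp
  rw [@norm_eq_sqrt_re_inner ℂ, @norm_eq_sqrt_re_inner ℂ, this]

lemma toTensor_surjective {n : ℕ} (z : L ⊗[ℂ] EuclideanSpace ℂ (Fin n)) :
    ∃ κ, toTensor κ = z := by
  induction z using TensorProduct.induction_on with
  | zero => exact ⟨0, by simp [toTensor]⟩
  | tmul x y =>
    refine ⟨WithLp.toLp 2 fun i => y i • x, ?_⟩
    conv_rhs => rw [← (EuclideanSpace.basisFun (Fin n) ℂ).sum_repr y]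
    simp only [toTensor, TensorProduct.tmul_sum, TensorProduct.smul_tmul,
      EuclideanSpace.basisFun_repr]
  | add a b ha hb =>
    obtain ⟨α, hα⟩ := ha
    obtain ⟨β, hβ⟩ := hb
    refine ⟨α + β, ?_⟩
    rw [← hα, ← hβ]
    simp [toTensor, TensorProduct.add_tmul, Finset.sum_add_distrib]

/-- All of `M_n`, as a space of operators. -/
abbrev matAlgTop (n : ℕ) : Submodule ℂ (MatAlg n) := allOps (EuclideanSpace ℂ (Fin n))

/-- The tensor `∑ p q, y p q ⊗ e_{pq}` in `B(L) ⊗ M_n`. -/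
def matTensor {n : ℕ} (y : Matrix (Fin n) (Fin n) (L →L[ℂ] L)) :
    AlgTensor (allOps L) (matAlgTop n) :=
  ∑ p, ∑ q, tmul ⟨y p q, trivial⟩ ⟨matUnit p q, trivial⟩

lemma spatial_matTensor {n : ℕ} (y : Matrix (Fin n) (Fin n) (L →L[ℂ] L))
    (κ : PiLp 2 (fun _ : Fin n => L)) :
    spatial _ _ (matTensor y) (toTensor κ) = toTensor (blockOp y κ) := by
  simp only [matTensor, toTensor, map_sum, sum_apply, spatial_tmul, TensorProduct.mapL_tmul,
    matUnit, InnerProductSpace.rankOne_apply,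
    orthonormal_iff_ite.1 (EuclideanSpace.basisFun (Fin n) ℂ).orthonormal, blockOp_apply,
    TensorProduct.sum_tmul, ite_smul, one_smul, zero_smul, TensorProduct.tmul_ite,
    Finset.sum_ite_eq', Finset.mem_univ, if_true]
  exact Finset.sum_comm

lemma norm_matTensor {n : ℕ} (y : Matrix (Fin n) (Fin n) (L →L[ℂ] L)) :
    ‖matTensor y‖ = ‖blockOp y‖ := by
  rw [algTensor_norm_def]
  refine le_antisymm (ContinuousLinearMap.opNorm_le_bound _ (ContinuousLinearMap.opNorm_nonneg _) fun ξ => ?_)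
    (ContinuousLinearMap.opNorm_le_bound _ (ContinuousLinearMap.opNorm_nonneg _) fun κ => ?_)
  · obtain ⟨κ, rfl⟩ := toTensor_surjective ξ
    rw [spatial_matTensor, norm_toTensor, norm_toTensor]
    exact ContinuousLinearMap.le_opNorm _ _
  · rw [← norm_toTensor, ← spatial_matTensor, ← norm_toTensor κ]
    exact ContinuousLinearMap.le_opNorm _ _

/-- The map `T ⊗ id : M_n(B(L)) → M_k(B(L))`. -/
def transfer {n k : ℕ} {V : Type*} [AddCommGroup V] [Module ℂ V] (T : MatAlg n →ₗ[ℂ] MatAlg k)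
    (y : Matrix (Fin n) (Fin n) V) : Matrix (Fin k) (Fin k) V :=
  Matrix.of fun i j => ∑ p, ∑ q, entry i j (T (matUnit p q)) • y p q

lemma tmul_sum_entry {k : ℕ} (w : allOps L) (a : matAlgTop k) :
    tmul w a = ∑ i, ∑ j, entry i j (a : MatAlg k) • tmul w (⟨matUnit i j, trivial⟩ : matAlgTop k) := by
  have ha : a = ∑ i, ∑ j, entry i j (a : MatAlg k) • (⟨matUnit i j, trivial⟩ : matAlgTop k) := by
    refine Subtype.ext ?_
    simpa using (sum_entry_smul_matUnit (a : MatAlg k)).symm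
  conv_lhs => rw [ha]
  change w ⊗ₜ[ℂ] _ = _
  simp only [TensorProduct.tmul_sum, TensorProduct.tmul_smul]
  rfl

lemma algAmpliation_matTensor {n k : ℕ} (T : MatAlg n →ₗ[ℂ] MatAlg k)
    (y : Matrix (Fin n) (Fin n) (L →L[ℂ] L)) :
    algAmpliation (allOps L) (onTop T) (matTensor y) = matTensor (transfer T y) := by
  have h : ∀ i j, tmul (⟨transfer T y i j, trivial⟩ : allOps L)
      (⟨matUnit i j, trivial⟩ : matAlgTop k) = ∑ p, ∑ q, entry i j (T (matUnit p q)) •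
        tmul (⟨y p q, trivial⟩ : allOps L) (⟨matUnit i j, trivial⟩ : matAlgTop k) := by
    intro i j
    have e : (⟨transfer T y i j, trivial⟩ : allOps L) =
        ∑ p, ∑ q, entry i j (T (matUnit p q)) • (⟨y p q, trivial⟩ : allOps L) := by
      refine Subtype.ext ?_
      simp [transfer]
    rw [e]
    change _ ⊗ₜ[ℂ] _ = _
    simp only [TensorProduct.sum_tmul]
    rfl
  simp only [matTensor, h, map_sum, algAmpliation_tmul]
  simp only [tmul_sum_entry _ (onTop T _)]
  calc _ = ∑ p, ∑ q, ∑ i, ∑ j, entry i j (T (matUnit p q)) •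
        tmul (⟨y p q, trivial⟩ : allOps L) (⟨matUnit i j, trivial⟩ : matAlgTop k) := rfl
    _ = ∑ x : (Fin n × Fin n), ∑ z : (Fin k × Fin k), entry z.1 z.2 (T (matUnit x.1 x.2)) •
        tmul (⟨y x.1 x.2, trivial⟩ : allOps L) (⟨matUnit z.1 z.2, trivial⟩ : matAlgTop k) := by
      simp only [Fintype.sum_prod_type]
    _ = _ := by
      rw [Finset.sum_comm]
      simp only [Fintype.sum_prod_type]

lemma norm_blockOp_transfer_le {n k : ℕ} (T : MatAlg n →ₗ[ℂ] MatAlg k)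
    (y : Matrix (Fin n) (Fin n) (L →L[ℂ] L)) :
    ‖blockOp (transfer T y)‖ ≤ (cbNorm T).toReal * ‖blockOp y‖ := by
  have hT := cbNorm_matAlg_lt_top T
  have hle := cbNorm_onTop_le T
  rw [← norm_matTensor, ← norm_matTensor, ← algAmpliation_matTensor]
  exact (norm_algAmpliation_le _ (hle.trans_lt hT) _).trans
    (mul_le_mul_of_nonneg_right (ENNReal.toReal_mono hT.ne hle) (norm_nonneg _))

lemma matNorm_transfer_le {V : Submodule ℂ (L →L[ℂ] L)} {n k : ℕ}
    (T : MatAlg n →ₗ[ℂ] MatAlg k) (y : Matrix (Fin n) (Fin n) V) :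
    MatrixNormed.matNorm k (transfer T y) ≤ (cbNorm T).toReal * MatrixNormed.matNorm n y := by
  rw [matNorm_def, matNorm_def]
  convert norm_blockOp_transfer_le T (y.map V.subtype) using 3
  ext1 i j
  simp [transfer]

end Transfer

section Coexact

variable {K L : Type*} [NormedAddCommGroup K] [InnerProductSpace ℂ K]
  [NormedAddCommGroup L] [InnerProductSpace ℂ L]
  {V : Submodule ℂ (K →L[ℂ] K)} {V' : Submodule ℂ (L →L[ℂ] L)}

/-- The norm of `M_k(T_n)` controls the images under all linear maps into operator spaces. -/
lemma matNorm_map_traceClass_le {n k : ℕ} (ψ : TraceClass n →ₗ[ℂ] V')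
    (σ : Matrix (Fin k) (Fin k) (TraceClass n)) :
    MatrixNormed.matNorm k (σ.map ψ) ≤
      MatrixNormed.matNorm k σ * MatrixNormed.matNorm n ((dualUnits n).map ψ) := by
  have e : σ.map ψ = transfer (traceMap σ) ((dualUnits n).map ψ) := by
    ext1 i j
    rw [Matrix.map_apply, eq_sum_dualUnits σ i j]
    simp only [map_sum, map_smul, transfer, Matrix.of_apply, Matrix.map_apply]
  rw [e]
  exact matNorm_transfer_le _ _

lemma eq_zero_of_matNorm_eq_zero {n : ℕ} {x : Matrix (Fin n) (Fin n) V}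
    (h : MatrixNormed.matNorm n x = 0) : x = 0 := by
  rw [matNorm_def, ContinuousLinearMap.opNorm_zero_iff] at h
  ext1 i j
  refine Subtype.ext (ContinuousLinearMap.ext fun ξ => ?_)
  have := congrArg (fun f => f (PiLp.single 2 j ξ) i) h
  simpa [blockOp_apply, Pi.single_apply, apply_ite] using this

end Coexact

section Coexact

variable {H K L : Type*} [NormedAddCommGroup H] [InnerProductSpace ℂ H]
  [NormedAddCommGroup K] [InnerProductSpace ℂ K] [NormedAddCommGroup L] [InnerProductSpace ℂ L]
  {V : Submodule ℂ (K →L[ℂ] K)} {V' : Submodule ℂ (L →L[ℂ] L)}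

lemma matNorm_zero (n : ℕ) : MatrixNormed.matNorm n (0 : Matrix (Fin n) (Fin n) V) = 0 := by
  simpa using matNorm_smul n 0 (0 : Matrix (Fin n) (Fin n) V)

lemma map_smul_matrix {n : ℕ} (φ : V →ₗ[ℂ] V') (c : ℂ) (x : Matrix (Fin n) (Fin n) V) :
    (c • x).map φ = c • x.map φ := by
  ext1 i j
  simp

lemma matNorm_map_le_of_forall_le_one {n : ℕ} (φ : V →ₗ[ℂ] V') {C : ℝ}
    {X : Submodule ℂ V} (h : ∀ x : Matrix (Fin n) (Fin n) V, (∀ i j, x i j ∈ X) →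
      MatrixNormed.matNorm n x ≤ 1 → MatrixNormed.matNorm n (x.map φ) ≤ C)
    {x : Matrix (Fin n) (Fin n) V} (hx : ∀ i j, x i j ∈ X) :
    MatrixNormed.matNorm n (x.map φ) ≤ C * MatrixNormed.matNorm n x := by
  rcases (matNorm_nonneg x).eq_or_lt with h0 | h0
  · rw [eq_zero_of_matNorm_eq_zero h0.symm, matNorm_zero]
    have : (0 : Matrix (Fin n) (Fin n) V).map φ = 0 := by ext1 i j; simp
    rw [this, matNorm_zero, mul_zero]
  · set r := MatrixNormed.matNorm n x with hr
    have hn : ‖((r⁻¹ : ℝ) : ℂ)‖ = r⁻¹ := by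
      rw [Complex.norm_real, Real.norm_of_nonneg (by positivity)]
    have := h (((r⁻¹ : ℝ) : ℂ) • x) (fun i j => X.smul_mem _ (hx i j))
      (by rw [matNorm_smul, hn, ← hr, inv_mul_cancel₀ h0.ne'])
    rw [map_smul_matrix, matNorm_smul, hn, inv_mul_le_iff₀ h0] at this
    linarith

lemma matNorm_map_le_toReal_cbNorm {V W : Type*} [AddCommGroup V] [Module ℂ V] [MatrixNormed V]
    [AddCommGroup W] [Module ℂ W] [MatrixNormed W] {φ : V →ₗ[ℂ] W} (hφ : cbNorm φ < ∞) {n : ℕ}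
    {v : Matrix (Fin n) (Fin n) V} (hv : MatrixNormed.matNorm n v ≤ 1) :
    MatrixNormed.matNorm n (v.map φ) ≤ (cbNorm φ).toReal :=
  (ENNReal.ofReal_le_iff_le_toReal hφ.ne).1
    (le_iSup_of_le n (le_iSup_of_le v (le_iSup_of_le hv le_rfl)))

lemma exists_equiv_of_cbDist_lt {V W : Type*} [AddCommGroup V] [Module ℂ V] [MatrixNormed V]
    [AddCommGroup W] [Module ℂ W] [MatrixNormed W] {r : ℝ}
    (h : cbDist V W < ENNReal.ofReal r) :
    0 < r ∧ ∃ (e : V ≃ₗ[ℂ] W) (a b : ℝ), 0 ≤ a ∧ 0 ≤ b ∧ a * b ≤ r ∧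
      (∀ (n : ℕ) (v : Matrix (Fin n) (Fin n) V), MatrixNormed.matNorm n v ≤ 1 →
        MatrixNormed.matNorm n (v.map e) ≤ a) ∧
      ∀ (n : ℕ) (w : Matrix (Fin n) (Fin n) W), MatrixNormed.matNorm n w ≤ 1 →
        MatrixNormed.matNorm n (w.map e.symm) ≤ b := by
  have hr : 0 < r := ENNReal.ofReal_pos.1 (lt_of_le_of_lt zero_le h)
  simp only [cbDist, iInf_lt_iff] at h
  obtain ⟨e, he, he', hlt⟩ := h
  refine ⟨hr, e, _, _, ENNReal.toReal_nonneg, ENNReal.toReal_nonneg, ?_,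
    fun n v hv => matNorm_map_le_toReal_cbNorm he hv,
    fun n w hw => matNorm_map_le_toReal_cbNorm he' hw⟩
  rw [← ENNReal.toReal_mul]
  exact ENNReal.toReal_le_of_le_ofReal hr.le hlt.le

/-- The matrices over a finite dimensional coexact space are controlled by a single matrix. -/
lemma Coexact.exists_matrix {l : ℝ} {X : Submodule ℂ V} (hX : Coexact l X) :
    0 ≤ l + 1 ∧ ∃ (n : ℕ) (τ : Matrix (Fin n) (Fin n) V), MatrixNormed.matNorm n τ ≤ 1 ∧
      ∀ (χ : V →ₗ[ℂ] V') (k : ℕ) (x : Matrix (Fin k) (Fin k) V), (∀ i j, x i j ∈ X) →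
        MatrixNormed.matNorm k (x.map χ) ≤
          (l + 1) * MatrixNormed.matNorm n (τ.map χ) * MatrixNormed.matNorm k x := by
  obtain ⟨n, W, hW⟩ := hX 1 one_pos
  obtain ⟨hl, e, a, b, ha0, hb0, hab, he, he'⟩ := exists_equiv_of_cbDist_lt hW
  have hbdd : ∀ (k : ℕ) (z : Matrix (Fin k) (Fin k) (TraceClass n ⧸ W)),
      BddBelow (MatrixNormed.matNorm k ''
        {v : Matrix (Fin k) (Fin k) (TraceClass n) | v.map W.mkQ = z}) := by
    rintro k z
    refine ⟨0, ?_⟩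
    rintro _ ⟨v, -, rfl⟩
    exact ENNReal.toReal_nonneg
  let q : TraceClass n →ₗ[ℂ] V := X.subtype ∘ₗ e.symm.toLinearMap ∘ₗ W.mkQ
  have hτ : MatrixNormed.matNorm n ((dualUnits n).map q) ≤ b := by
    have h1 : MatrixNormed.matNorm n ((dualUnits n).map W.mkQ) ≤ 1 :=
      (csInf_le (hbdd n _) ⟨_, rfl, rfl⟩).trans (matNorm_dualUnits_le n)
    exact he' n _ h1
  have key : ∀ (χ : V →ₗ[ℂ] V') (k : ℕ) (x : Matrix (Fin k) (Fin k) V), (∀ i j, x i j ∈ X) →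
      MatrixNormed.matNorm k (x.map χ) ≤
        a * MatrixNormed.matNorm n (((dualUnits n).map q).map χ) * MatrixNormed.matNorm k x := by
    intro χ k x hx
    refine matNorm_map_le_of_forall_le_one χ (fun x hx h1 => ?_) hx
    let y : Matrix (Fin k) (Fin k) X := Matrix.of fun i j => ⟨x i j, hx i j⟩
    have hz : MatrixNormed.matNorm k (y.map e) ≤ a := he k y h1
    have hD : 0 ≤ MatrixNormed.matNorm n (((dualUnits n).map q).map χ) := matNorm_nonneg _
    have hδ : ∀ δ : ℝ, 0 < δ → MatrixNormed.matNorm k (x.map χ) ≤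
        (a + δ) * MatrixNormed.matNorm n (((dualUnits n).map q).map χ) := by
      intro δ hδ
      have hne : (MatrixNormed.matNorm k '' {v : Matrix (Fin k) (Fin k) (TraceClass n) |
          v.map W.mkQ = y.map e}).Nonempty := by
        choose f hf using W.mkQ_surjective
        refine ⟨_, (y.map e).map f, ?_, rfl⟩
        ext1 i j
        exact hf _
      obtain ⟨_, ⟨σ, hσ, rfl⟩, hlt⟩ := exists_lt_of_csInf_lt hne
        (lt_of_le_of_lt hz (lt_add_of_pos_right a hδ))
      have e1 : x.map χ = σ.map (χ ∘ₗ q) := by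
        ext1 i j
        have h3 : W.mkQ (σ i j) = e (y i j) := congrFun (congrFun hσ i) j
        change χ (x i j) = χ (e.symm (W.mkQ (σ i j)) : X)
        rw [h3, e.symm_apply_apply]
        rfl
      rw [e1]
      refine (matNorm_map_traceClass_le _ σ).trans ?_
      exact mul_le_mul_of_nonneg_right hlt.le hD
    refine le_of_forall_pos_le_add fun ε hε => ?_
    have h4 := hδ (ε / (MatrixNormed.matNorm n (((dualUnits n).map q).map χ) + 1)) (by positivity)
    rw [add_mul] at h4
    refine h4.trans (add_le_add le_rfl ?_)
    rw [div_mul_eq_mul_div, div_le_iff₀ (by positivity)]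
    nlinarith
  have hn : ‖((b⁻¹ : ℝ) : ℂ)‖ = b⁻¹ := by
    rw [Complex.norm_real, Real.norm_of_nonneg (by positivity)]
  refine ⟨hl.le, n, ((b⁻¹ : ℝ) : ℂ) • (dualUnits n).map q, ?_, fun χ k x hx => ?_⟩
  · rw [matNorm_smul, hn]
    exact inv_mul_le_one_of_le₀ hτ hb0
  · refine (key χ k x hx).trans (mul_le_mul_of_nonneg_right ?_ (matNorm_nonneg x))
    rw [map_smul_matrix, matNorm_smul, hn]
    have hD : 0 ≤ MatrixNormed.matNorm n (((dualUnits n).map q).map χ) := matNorm_nonneg _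
    rcases hb0.eq_or_lt with h0 | h0
    · have h5 : (dualUnits n).map q = 0 :=
        eq_zero_of_matNorm_eq_zero (le_antisymm (hτ.trans h0.ge) (matNorm_nonneg _))
      have h6 : ((dualUnits n).map q).map χ = 0 := by rw [h5]; ext1 i j; simp
      rw [h6, matNorm_zero]
      simp
    · rw [← mul_assoc]
      refine mul_le_mul_of_nonneg_right ?_ hD
      rwa [← div_eq_mul_inv, le_div_iff₀ h0]

/-- Over a subcoexact space, the ampliations of a given tensor are controlled by the amplifications
of a single matrix. -/
lemma Subcoexact.exists_matrix {l : ℝ} (hV : Subcoexact l V) (W : Submodule ℂ (H →L[ℂ] H))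
    (u : AlgTensor W V) :
    ∃ (n : ℕ) (τ : Matrix (Fin n) (Fin n) V), MatrixNormed.matNorm n τ ≤ 1 ∧
      ∀ χ : V →ₗ[ℂ] V', ‖algAmpliation W χ u‖ ≤
          (l + 1) * MatrixNormed.matNorm n (τ.map χ) * ‖u‖ := by
  obtain ⟨X₀, hfin, hmem⟩ := exists_finiteDimensional_slice_mem u
  obtain ⟨X, hle, -, hX⟩ := hV X₀ hfin
  obtain ⟨hl, n, τ, hτ, h⟩ := hX.exists_matrix (V' := V')
  refine ⟨n, τ, hτ, fun χ => ?_⟩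
  have h0 : 0 ≤ (l + 1) * MatrixNormed.matNorm n (τ.map χ) := mul_nonneg hl (matNorm_nonneg _)
  refine norm_le_of_forall_slice (mul_nonneg h0 (norm_nonneg u)) fun k e he => ?_
  rw [slice_algAmpliation]
  refine (h χ k (slice e u) fun i j => hle (hmem _ _)).trans ?_
  exact mul_le_mul_of_nonneg_left (norm_slice_le he u) h0

lemma Subcoexact.nonneg {l : ℝ} (hV : Subcoexact l V) : 0 ≤ l + 1 := by
  obtain ⟨X, -, -, hX⟩ := hV ⊥ inferInstance
  exact (hX.exists_matrix (V' := V)).1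

end Coexact

section Ampliation

variable {H K L : Type*} [NormedAddCommGroup H] [InnerProductSpace ℂ H]
  [NormedAddCommGroup K] [InnerProductSpace ℂ K] [NormedAddCommGroup L] [InnerProductSpace ℂ L]
  {V : Submodule ℂ (K →L[ℂ] K)} {V' : Submodule ℂ (L →L[ℂ] L)}

lemma ampliation_coe (W : Submodule ℂ (H →L[ℂ] H)) (φ : CB V V') (u : AlgTensor W V) :
    ampliation W φ (u : MinTensor W V) = (algAmpliation W φ.1 u : AlgTensor W V') :=
  NormedAddGroupHom.completion_coe _ u

lemma continuous_ampliation (W : Submodule ℂ (H →L[ℂ] H)) (φ : CB V V') :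
    Continuous (ampliation W φ) :=
  NormedAddGroupHom.continuous _

lemma algAmpliation_sub (W : Submodule ℂ (H →L[ℂ] H)) (φ ψ : V →ₗ[ℂ] V') (u : AlgTensor W V) :
    algAmpliation W (φ - ψ) u = algAmpliation W φ u - algAmpliation W ψ u := by
  rw [algAmpliation, LinearMap.lTensor_sub]
  rfl

lemma dist_ampliation_coe (W : Submodule ℂ (H →L[ℂ] H)) (φ ψ : CB V V') (u : AlgTensor W V) :
    dist (ampliation W φ (u : MinTensor W V)) (ampliation W ψ (u : MinTensor W V)) =
      ‖algAmpliation W (φ.1 - ψ.1) u‖ := by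
  rw [ampliation_coe, ampliation_coe, algAmpliation_sub, UniformSpace.Completion.dist_eq,
    dist_eq_norm]

lemma induced_le_induced_of_dist_le {X M N : Type*} [PseudoMetricSpace M] [PseudoMetricSpace N]
    {f : X → M} {g : X → N} {C : ℝ} (h : ∀ x y, dist (f x) (f y) ≤ C * dist (g x) (g y)) :
    TopologicalSpace.induced g inferInstance ≤ TopologicalSpace.induced f inferInstance := by
  let _ : TopologicalSpace X := TopologicalSpace.induced g inferInstance
  have hg : Continuous g := continuous_induced_dom
  refine continuous_iff_le_induced.1 (continuous_iff_continuousAt.2 fun x => ?_)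
  rw [ContinuousAt, tendsto_iff_dist_tendsto_zero]
  refine squeeze_zero (fun _ => dist_nonneg) (fun y => h y x) ?_
  have := (tendsto_iff_dist_tendsto_zero.1 (hg.tendsto x)).const_mul C
  simpa using this

end Ampliation

open Filter

section Topologies

variable {H : Type*} [NormedAddCommGroup H] [InnerProductSpace ℂ H]

lemma rankOne_mem_compactOperator (x y : H) :
    InnerProductSpace.rankOne ℂ x y ∈ compactOperator (RingHom.id ℂ) H H := by
  have h : IsCompactOperator (innerSL ℂ y) :=
    isCompactOperator_of_locallyCompactSpace_dom (innerSL ℂ y)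
  rw [InnerProductSpace.rankOne_def']
  exact h.clm_comp (ContinuousLinearMap.toSpanSingleton ℂ x)

/-- The standard basis of `ℓ²`. -/
def stdHilbertBasis : HilbertBasis ℕ ℂ ℓ²(ℕ, ℂ) := default

/-- Orthonormal families in `ℓ²`, orthogonal for different `k`. -/
def blockFamily (k n : ℕ) (i : Fin n) : ℓ²(ℕ, ℂ) := stdHilbertBasis (Nat.pair k i)

lemma orthonormal_blockFamily (k n : ℕ) : Orthonormal ℂ (blockFamily k n) :=
  stdHilbertBasis.orthonormal.comp (fun i : Fin n => Nat.pair k i) fun _ _ h =>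
    Fin.ext (Nat.pair_eq_pair.1 h).2

lemma inner_blockFamily_of_ne {k k' : ℕ} (h : k ≠ k') (n n' : ℕ) (i : Fin n) (j : Fin n') :
    inner ℂ (blockFamily k n i) (blockFamily k' n' j) = 0 :=
  stdHilbertBasis.orthonormal.2 fun e => h (Nat.pair_eq_pair.1 e).1

variable {K : Type*} [NormedAddCommGroup K] [InnerProductSpace ℂ K] {V : Submodule ℂ (K →L[ℂ] K)}

lemma algTensor_exists_series {W : Submodule ℂ (H →L[ℂ] H)} (u : MinTensor W V) :
    ∃ (a : ℕ → AlgTensor W V) (M : ℝ), 0 ≤ M ∧ (∀ n, ‖a n‖ ≤ M * (1 / 4) ^ n) ∧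
      Tendsto (fun n => ((∑ i ∈ Finset.range n, a i : AlgTensor W V) : MinTensor W V))
        atTop (𝓝 u) := by
  have hu : u ∈ closure ((NormedAddCommGroup.toCompl (G := AlgTensor W V)).toAddMonoidHom.range :
      Set (MinTensor W V)) :=
    NormedAddCommGroup.denseRange_toCompl u
  obtain ⟨a, ha, -, hn⟩ := controlled_sum_of_mem_closure_range hu
    (f := fun n => (1 / 4 : ℝ) ^ n) (fun n => by positivity)
  refine ⟨a, max ‖a 0‖ 1, by positivity, fun n => ?_, ?_⟩
  · rcases Nat.eq_zero_or_pos n with rfl | h0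
    · simp
    · have h1 : ‖a n‖ < (1 / 4) ^ n := by
        have := hn n h0
        rwa [← UniformSpace.Completion.norm_coe (a n)]
      refine h1.le.trans ?_
      exact le_mul_of_one_le_left (by positivity) (le_max_right _ _)
  · refine (tendsto_add_atTop_iff_nat 1).1 ?_
    convert ha using 2 with n
    exact map_sum (NormedAddCommGroup.toCompl (G := AlgTensor W V)).toAddMonoidHom a _

lemma exists_compacts_block_sum (n : ℕ → ℕ) (τ : ∀ k, Matrix (Fin (n k)) (Fin (n k)) V)
    (hτ : ∀ k, MatrixNormed.matNorm (n k) (τ k) ≤ 1) :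
    ∃ w : MinTensor compacts V, ∀ (φ ψ : CB V V) (k : ℕ),
      MatrixNormed.matNorm (n k) ((τ k).map ⇑(φ.1 - ψ.1)) ≤
        2 ^ k * dist (ampliation compacts φ w) (ampliation compacts ψ w) := by
  have hmem : ∀ k (i j : Fin (n k)), InnerProductSpace.rankOne ℂ (blockFamily k (n k) i)
      (blockFamily k (n k) j) ∈ compacts := fun k i j => rankOne_mem_compactOperator _ _
  have hc : ∀ k : ℕ, ‖((1 / 2 : ℂ)) ^ k‖ = (1 / 2 : ℝ) ^ k := fun k => by simp
  let z : ℕ → AlgTensor compacts V := fun k =>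
    embed (blockFamily k (n k)) (hmem k) ((1 / 2 : ℂ) ^ k • τ k)
  have hz : ∀ k, ‖(z k : MinTensor compacts V)‖ ≤ (1 / 2 : ℝ) ^ k := fun k => by
    rw [UniformSpace.Completion.norm_coe]
    refine (norm_embed_le (orthonormal_blockFamily k (n k)) (hmem k) _).trans ?_
    rw [matNorm_smul, hc]
    exact mul_le_of_le_one_right (by positivity) (hτ k)
  have hs : Summable fun k => (z k : MinTensor compacts V) :=
    Summable.of_norm_bounded summable_geometric_two hz
  refine ⟨∑' k, (z k : MinTensor compacts V), fun φ ψ k => ?_⟩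
  have hlim : Tendsto (fun N => ((∑ i ∈ Finset.range N, z i : AlgTensor compacts V) :
      MinTensor compacts V)) atTop (𝓝 (∑' k, (z k : MinTensor compacts V))) := by
    convert hs.hasSum.tendsto_sum_nat using 2 with N
    exact map_sum (NormedAddCommGroup.toCompl (G := AlgTensor compacts V)).toAddMonoidHom z _
  have hdist := (((continuous_ampliation compacts φ).tendsto _).comp hlim).dist
    (((continuous_ampliation compacts ψ).tendsto _).comp hlim)
  suffices h : (1 / 2 : ℝ) ^ k * MatrixNormed.matNorm (n k) ((τ k).map ⇑(φ.1 - ψ.1)) ≤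
      dist (ampliation compacts φ (∑' k, (z k : MinTensor compacts V)))
        (ampliation compacts ψ (∑' k, (z k : MinTensor compacts V))) by
    rwa [one_div, inv_pow, inv_mul_le_iff₀ (by positivity)] at h
  refine ge_of_tendsto hdist ?_
  filter_upwards [eventually_gt_atTop k] with N hN
  simp only [Function.comp_apply, dist_ampliation_coe]
  refine le_trans (le_of_eq ?_) (norm_slice_le (orthonormal_blockFamily k (n k)) _)
  rw [map_sum, slice_sum, Finset.sum_eq_single_of_mem k (Finset.mem_range.2 hN)]
  · rw [algAmpliation_embed, slice_embed_self (orthonormal_blockFamily k (n k)), map_smul_matrix,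
      matNorm_smul, hc]
  · intro j _ hj
    rw [algAmpliation_embed]
    exact slice_embed_of_orthogonal (fun i p => inner_blockFamily_of_ne hj.symm _ _ i p) _ _

/-- Over a subcoexact space, every tensor is controlled by a tensor with compact first factor. -/
lemma Subcoexact.exists_compacts_dist_le {l : ℝ} (hV : Subcoexact l V)
    {W : Submodule ℂ (H →L[ℂ] H)} (u : MinTensor W V) :
    ∃ (w : MinTensor compacts V) (C : ℝ), ∀ φ ψ : CB V V,
      dist (ampliation W φ u) (ampliation W ψ u) ≤
        C * dist (ampliation compacts φ w) (ampliation compacts ψ w) := by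
  obtain ⟨a, M, hM, ha, hlim⟩ := algTensor_exists_series u
  choose n τ hτ h using fun k => hV.exists_matrix (V' := V) W (a k)
  obtain ⟨w, hw⟩ := exists_compacts_block_sum n τ hτ
  refine ⟨w, (l + 1) * M * 2, fun φ ψ => ?_⟩
  set D := dist (ampliation compacts φ w) (ampliation compacts ψ w) with hD
  have hD0 : 0 ≤ D := dist_nonneg
  have hl := hV.nonneg
  have hdist := (((continuous_ampliation W φ).tendsto _).comp hlim).dist
    (((continuous_ampliation W ψ).tendsto _).comp hlim)
  refine le_of_tendsto' hdist fun N => ?_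
  simp only [Function.comp_apply, dist_ampliation_coe, map_sum]
  calc ‖∑ k ∈ Finset.range N, algAmpliation W (φ.1 - ψ.1) (a k)‖
      ≤ ∑ k ∈ Finset.range N, ‖algAmpliation W (φ.1 - ψ.1) (a k)‖ := norm_sum_le _ _
    _ ≤ ∑ k ∈ Finset.range N, (l + 1) * M * D * (1 / 2) ^ k := by
        refine Finset.sum_le_sum fun k _ => (h k _).trans ?_
        calc _ ≤ (l + 1) * (2 ^ k * D) * (M * (1 / 4) ^ k) := by
              gcongr
              · exact hw φ ψ k
              · exact ha k
          _ = (l + 1) * M * D * (2 * (1 / 4)) ^ k := by rw [mul_pow]; ring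
          _ = _ := by norm_num
    _ = (l + 1) * M * D * ∑ k ∈ Finset.range N, (1 / 2) ^ k := by rw [Finset.mul_sum]
    _ ≤ (l + 1) * M * D * 2 := by gcongr; exact sum_geometric_two_le N
    _ = _ := by ring

end Topologies

section Conjugation

variable {H H' K : Type*} [NormedAddCommGroup H] [InnerProductSpace ℂ H]
  [NormedAddCommGroup H'] [InnerProductSpace ℂ H'] [NormedAddCommGroup K] [InnerProductSpace ℂ K]
  {V : Submodule ℂ (K →L[ℂ] K)} {W : Submodule ℂ (H →L[ℂ] H)}

/-- Conjugation of the first factor by a unitary. -/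
def conjTensor (W : Submodule ℂ (H →L[ℂ] H)) (V : Submodule ℂ (K →L[ℂ] K)) (U : H ≃ₗᵢ[ℂ] H') :
    AlgTensor W V →ₗ[ℂ] AlgTensor (allOps H') V :=
  LinearMap.rTensor V ((twoSidedMul (U.toContinuousLinearEquiv : H →L[ℂ] H')
    (U.symm.toContinuousLinearEquiv : H' →L[ℂ] H) ∘ₗ W.subtype).codRestrict (allOps H')
      fun _ => trivial)

lemma conjTensor_tmul (U : H ≃ₗᵢ[ℂ] H') (w : W) (v : V) :
    conjTensor W V U (tmul w v) = 
      tmul (⟨twoSidedMul (U.toContinuousLinearEquiv : H →L[ℂ] H')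
        (U.symm.toContinuousLinearEquiv : H' →L[ℂ] H) w, trivial⟩ : allOps H') v := rfl

lemma slice_conjTensor (U : H ≃ₗᵢ[ℂ] H') {n : ℕ} (e : Fin n → H) (u : AlgTensor W V) :
    slice (U ∘ e) (conjTensor W V U u) = slice e u := by
  ext1 i j
  simp only [slice, Matrix.of_apply, Function.comp_apply]
  refine tensor_induction (p := fun u => sliceMap (U (e i)) (U (e j)) (conjTensor W V U u) =
    sliceMap (e i) (e j) u) ?_ (fun w v => ?_) (fun a b ha hb => ?_) u
  · simp only [map_zero]
  · rw [conjTensor_tmul, sliceMap_tmul, sliceMap_tmul]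
    simp [twoSidedMul]
  · rw [map_add, map_add, map_add, ha, hb]

lemma norm_conjTensor (U : H ≃ₗᵢ[ℂ] H') (u : AlgTensor W V) : ‖conjTensor W V U u‖ = ‖u‖ := by
  refine le_antisymm (norm_le_of_forall_slice (norm_nonneg u) fun n e he => ?_)
    (norm_le_of_forall_slice (norm_nonneg (conjTensor W V U u)) fun n e he => ?_)
  · have h : e = U ∘ (U.symm ∘ e) := by ext1 i; simp
    rw [h, slice_conjTensor]
    exact norm_slice_le (he.comp_linearIsometry U.symm.toLinearIsometry) u
  · rw [← slice_conjTensor U]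
    exact norm_slice_le (he.comp_linearIsometry U.toLinearIsometry) _

lemma algAmpliation_conjTensor (U : H ≃ₗᵢ[ℂ] H') (φ : V →ₗ[ℂ] V) (u : AlgTensor W V) :
    algAmpliation (allOps H') φ (conjTensor W V U u) =
      conjTensor W V U (algAmpliation W φ u) := by
  refine tensor_induction (p := fun u => algAmpliation (allOps H') φ (conjTensor W V U u) =
    conjTensor W V U (algAmpliation W φ u)) ?_ (fun w v => rfl) (fun a b ha hb => ?_) u
  · simp only [map_zero]
  · rw [map_add, map_add, map_add, map_add, ha, hb]

lemma exists_allOps_dist_le (U : H ≃ₗᵢ[ℂ] H') (w : MinTensor W V) :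
    ∃ u : MinTensor (allOps H') V, ∀ φ ψ : CB V V,
      dist (ampliation W φ w) (ampliation W ψ w) ≤
        1 * dist (ampliation (allOps H') φ u) (ampliation (allOps H') ψ u) := by
  let J : NormedAddGroupHom (AlgTensor W V) (AlgTensor (allOps H') V) :=
    (conjTensor W V U).toAddMonoidHom.mkNormedAddGroupHom 1 fun u => by
      rw [one_mul]
      exact (norm_conjTensor U u).le
  refine ⟨J.completion w, fun φ ψ => ?_⟩
  rw [one_mul]
  induction w using UniformSpace.Completion.induction_on with
  | hp =>
    exact isClosed_le
      ((continuous_ampliation W φ).dist (continuous_ampliation W ψ))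
      (((continuous_ampliation _ φ).comp J.completion.continuous).dist
        ((continuous_ampliation _ ψ).comp J.completion.continuous))
  | ih u =>
    rw [NormedAddGroupHom.completion_coe, dist_ampliation_coe, dist_ampliation_coe]
    change _ ≤ ‖algAmpliation (allOps H') (φ.1 - ψ.1) (conjTensor W V U u)‖
    rw [algAmpliation_conjTensor, norm_conjTensor]

end Conjugation

/-- Every universe contains a copy of `ℓ²`. -/
def liftHilbertBasis : HilbertBasis (ULift.{v} ℕ) ℂ ℓ²(ℕ, ℂ) :=
  HilbertBasis.mk (stdHilbertBasis.orthonormal.comp ULift.down ULift.down_injective) <| by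
    rw [ULift.down_surjective.range_comp]
    exact stdHilbertBasis.dense_span.ge

section Equality

variable {K : Type u} [NormedAddCommGroup K] [InnerProductSpace ℂ K] {V : Submodule ℂ (K →L[ℂ] K)}

lemma stronglyStablePointNorm_le_stablePointNorm :
    stronglyStablePointNorm.{u, v, u} V V ≤ stablePointNorm V V := by
  refine le_iInf fun w => ?_
  obtain ⟨u, hu⟩ := exists_allOps_dist_le liftHilbertBasis.{v}.repr w
  refine le_trans ?_ (induced_le_induced_of_dist_le hu)
  exact iInf_le_of_le _ (iInf_le_of_le _ (iInf_le_of_le _ (iInf_le_of_le inferInstance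
    (iInf_le _ u))))

lemma Subcoexact.stablePointNorm_eq {l : ℝ} (hV : Subcoexact l V) :
    stablePointNorm V V = stronglyStablePointNorm.{u, v, u} V V := by
  refine le_antisymm ?_ stronglyStablePointNorm_le_stablePointNorm
  refine le_iInf fun H => le_iInf fun _ => le_iInf fun _ => le_iInf fun _ => le_iInf fun u => ?_
  obtain ⟨w, C, h⟩ := hV.exists_compacts_dist_le u
  exact (iInf_le _ w).trans (induced_le_induced_of_dist_le h)

end Equality

end OperatorSpace

end

theorem mainTheorem4 {K : Type u} [NormedAddCommGroup K] [InnerProductSpace ℂ K] [CompleteSpace K]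
    (V : Submodule ℂ (K →L[ℂ] K)) (hV : IsClosed (V : Set (K →L[ℂ] K)))
    (l : ℝ) (hl : OperatorSpace.Subcoexact l V) :
    OperatorSpace.OAP V ↔ OperatorSpace.StrongOAP.{u, v} V := by
  unfold OperatorSpace.OAP OperatorSpace.StrongOAP
  rw [hl.stablePointNorm_eq]
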